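/- Let $G$ be a finite, simple, connected, triangle-free graph of order $n$ and minimum degree $\delta \ge 1$, and let $k \ge 1$ be an integer. For a non-empty set $S$ of vertices of $G$, the Steiner distance $d_G(S)$ is the minimum number of edges of a connected subgraph of $G$ containing all vertices of $S$, and the Steiner $k$-Wiener index of $G$ is $SW_k(G) = \sum_{S \subseteq V(G),\, |S| = k} d_G(S)$. Then $$SW_k(G) \le \frac{k-1}{k+1}\,\frac{2(n+1)}{\delta}\binom{n}{k} + \Big(\frac{4\delta-2}{\delta} + 3k + 1\Big)\binom{n}{k},$$ and thus, if $k \le n$, the average Steiner $k$-distance $\mu_k(G) = \binom{n}{k}^{-1} SW_k(G)$ satisfies $$\mu_k(G) \le \frac{k-1}{k+1}\,\frac{2(n+1)}{\delta} + \frac{4\delta-2}{\delta} + 3k + 1.$$ -/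

import Mathlib

namespace SimpleGraph

/-- The Steiner distance of a set `S` of vertices of `G`: the minimum size (number of edges) of a
connected subgraph of `G` containing all vertices of `S`. If `G` is connected and finite, the
minimum is over a nonempty set of numbers, since `G` itself is such a subgraph. -/
noncomputable def steinerDist {V : Type*} (G : SimpleGraph V) (S : Set V) : ℕ :=
  sInf {m : ℕ | ∃ H : G.Subgraph, H.Connected ∧ S ⊆ H.verts ∧ H.edgeSet.ncard = m}

/-- The Steiner `k`-Wiener index: the sum of the Steiner distances of all `k`-element sets of
vertices. -/
noncomputable def steinerWiener {V : Type*} [Fintype V] (G : SimpleGraph V) (k : ℕ) : ℕ :=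
  ∑ S ∈ (Finset.univ : Finset V).powersetCard k, G.steinerDist (S : Set V)

/-- The average Steiner `k`-distance: the average of the Steiner distances of all `k`-element
sets of vertices (meaningful for `k` at most the order of `G`). -/
noncomputable def avgSteinerDist {V : Type*} [Fintype V] (G : SimpleGraph V) (k : ℕ) : ℝ :=
  ((Fintype.card V).choose k : ℝ)⁻¹ * (G.steinerWiener k : ℝ)

end SimpleGraph

open Finset

/-! Take a largest family of edges at mutual distance at least 3, grown so that each new edge lies
within 3 of an earlier one. The family forms a tree, and every vertex is within 3 of a member
(`exists_dartTree`). Triangle-freeness gives the two ends of an edge at least w = 2δ neighbours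
together, and these neighbourhoods are disjoint for different members. So the vertices split into
classes of size at least w, each vertex close to its own member (`exists_assignment`).

Joining a k-set S to its members, and these through the tree, costs at most 1 + 3k plus 4 per tree
edge that separates S (`steinerDist_le_card_separating`). Summed over S, a tree edge with b vertices
on one side contributes `sepCount n k b`, which is symmetric in b and n - b and nondecreasing up to
n/2. At most (n - 2x)/w + 1 tree edges have x vertices on both sides (`mul_card_balanced_add_le`).
Hence the total is at most 1/w times the sum of `sepCount` over all b, up to an error of (w - 1)/w ·
C(n,k) (`sum_sepCount_le`). -/

/-! ### Counting separated k-sets -/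

/-- The number of `k`-subsets of an `n`-set that are separated by a fixed `b`-subset. -/
noncomputable def sepCount (n k b : ℕ) : ℝ :=
  (n.choose k : ℝ) - (b.choose k : ℝ) - ((n - b).choose k : ℝ)

/-- An unseparated set lies in `D` or in its complement; as `k ≥ 1`, not in both. -/
theorem card_separated {V : Type*} [Fintype V] [DecidableEq V] {k : ℕ} (hk : 1 ≤ k)
    (D : Finset V) :
    ((((univ : Finset V).powersetCard k).filter
      (fun S => (∃ s ∈ S, s ∈ D) ∧ ∃ s ∈ S, s ∉ D)).card : ℝ)
      = sepCount (Fintype.card V) k D.card := by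
  set P := (univ : Finset V).powersetCard k
  have h1 : P = P.filter (fun S => (∃ s ∈ S, s ∈ D) ∧ ∃ s ∈ S, s ∉ D) ∪
      (D.powersetCard k ∪ Dᶜ.powersetCard k) := by
    ext S
    simp only [P, mem_union, mem_filter, mem_powersetCard, subset_univ, true_and]
    constructor
    · intro h
      by_cases hD : ∃ s ∈ S, s ∈ D
      · by_cases hD' : ∃ s ∈ S, s ∉ D
        · exact Or.inl ⟨h, hD, hD'⟩
        · push Not at hD'
          exact Or.inr (Or.inl ⟨hD', h⟩)
      · push Not at hD
        exact Or.inr (Or.inr ⟨fun s hs => by simpa using hD s hs, h⟩)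
    · tauto
  have h2 : Disjoint (D.powersetCard k) (Dᶜ.powersetCard k) := by
    rw [Finset.disjoint_left]
    intro S hS hS'
    rw [mem_powersetCard] at hS hS'
    obtain ⟨s, hs⟩ : S.Nonempty := by rw [← card_pos]; omega
    have := hS'.1 hs
    simp [hS.1 hs] at this
  have h3 : Disjoint (P.filter (fun S => (∃ s ∈ S, s ∈ D) ∧ ∃ s ∈ S, s ∉ D))
      (D.powersetCard k ∪ Dᶜ.powersetCard k) := by
    rw [Finset.disjoint_left]
    intro S hS hS'
    rw [mem_filter] at hS
    obtain ⟨-, ⟨a, ha, haD⟩, b, hb, hbD⟩ := hS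
    rw [mem_union, mem_powersetCard, mem_powersetCard] at hS'
    rcases hS' with h | h
    · exact hbD (h.1 hb)
    · have := h.1 ha
      simp [haD] at this
  have h4 := congrArg Finset.card h1
  rw [card_union_of_disjoint h3, card_union_of_disjoint h2] at h4
  simp only [P, card_powersetCard, card_univ, card_compl] at h4
  unfold sepCount
  rw [h4]
  push_cast
  ring

theorem sepCount_zero {n k : ℕ} (hk : 1 ≤ k) : sepCount n k 0 = 0 := by
  simp [sepCount, Nat.choose_eq_zero_of_lt hk]

theorem sepCount_symm {n k b : ℕ} (hb : b ≤ n) : sepCount n k (n - b) = sepCount n k b := by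
  unfold sepCount
  rw [Nat.sub_sub_self hb]
  ring

theorem sepCount_le (n k b : ℕ) : sepCount n k b ≤ n.choose k := by
  unfold sepCount
  have h1 : (0 : ℝ) ≤ (b.choose k : ℝ) := by positivity
  have h2 : (0 : ℝ) ≤ ((n - b).choose k : ℝ) := by positivity
  linarith

/-- By Pascal's rule the increment is C(n-x-1, k-1) - C(x, k-1). -/
theorem sepCount_le_succ {n k x : ℕ} (hk : 1 ≤ k) (hx : 2 * (x + 1) ≤ n) :
    sepCount n k x ≤ sepCount n k (x + 1) := by
  obtain ⟨k, rfl⟩ : ∃ j, k = j + 1 := ⟨k - 1, by omega⟩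
  obtain ⟨m, rfl⟩ : ∃ m, n = m + x + 1 := ⟨n - x - 1, by omega⟩
  unfold sepCount
  rw [show m + x + 1 - x = m + 1 by omega, show m + x + 1 - (x + 1) = m by omega,
    Nat.choose_succ_succ x k, Nat.choose_succ_succ m k]
  have : ((x.choose k : ℕ) : ℝ) ≤ (m.choose k : ℕ) := by
    exact_mod_cast Nat.choose_le_choose k (by omega)
  push_cast
  linarith

theorem sum_range_choose_eq (m k : ℕ) :
    ∑ x ∈ range m, ((x.choose k : ℕ) : ℝ) = (m.choose (k + 1) : ℕ) := by
  induction m with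
  | zero => simp
  | succ m ih =>
    rw [sum_range_succ, ih, Nat.choose_succ_succ]
    push_cast
    ring

/-- The hockey-stick identity, used twice, gives (n+1)C(n,k) - 2C(n+1,k+1), and C(n+1,k+1) =
(n+1)C(n,k)/(k+1). -/
theorem sum_sepCount (n k : ℕ) :
    ∑ a ∈ range (n + 1), sepCount n k a =
      ((k : ℝ) - 1) / ((k : ℝ) + 1) * ((n : ℝ) + 1) * n.choose k := by
  have h1 : ∑ a ∈ range (n + 1), (((n - a).choose k : ℕ) : ℝ)
      = ((n + 1).choose (k + 1) : ℕ) := by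
    rw [← sum_range_choose_eq, ← Finset.sum_range_reflect]
    refine sum_congr rfl fun a ha => ?_
    rw [mem_range] at ha
    simp [show n - (n - a) = a by omega]
  have h2 : ((n : ℝ) + 1) * n.choose k = ((n + 1).choose (k + 1) : ℕ) * ((k : ℝ) + 1) := by
    exact_mod_cast Nat.add_one_mul_choose_eq n k
  unfold sepCount
  rw [sum_sub_distrib, sum_sub_distrib, h1, sum_range_choose_eq]
  simp only [sum_const, card_range, nsmul_eq_mul]
  push_cast
  field_simp
  linear_combination 2 * h2

/-- Folding along a ↦ n - a; the middle value occurs once for even n and twice for odd n. -/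
theorem sum_sepCount_half (n k h : ℕ) (hn : n = 2 * h ∨ n = 2 * h + 1) :
    2 * ∑ x ∈ range h, sepCount n k x + sepCount n k h * ((n : ℝ) - 2 * h + 1) =
      ∑ a ∈ range (n + 1), sepCount n k a := by
  have key : ∀ m, m + h = n + 1 →
      ∑ a ∈ range (n + 1), sepCount n k a =
        ∑ a ∈ range m, sepCount n k a + ∑ a ∈ range h, sepCount n k a := by
    intro m hm
    rw [← hm, sum_range_add]
    congr 1
    rw [← Finset.sum_range_reflect]
    refine sum_congr rfl fun a ha => ?_
    rw [mem_range] at ha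
    rw [← sepCount_symm (b := a) (by omega)]
    congr 1
    omega
  rcases hn with rfl | rfl
  · rw [key (h + 1) (by omega), sum_range_succ]
    push_cast
    ring
  · rw [key (h + 2) (by omega), sum_range_succ, sum_range_succ,
      ← sepCount_symm (n := 2 * h + 1) (b := h) (by omega),
      show 2 * h + 1 - h = h + 1 by omega]
    push_cast
    ring

/-- Summation by parts. -/
theorem sum_increments_mul (f : ℕ → ℝ) (hf : f 0 = 0) (c : ℝ) (h : ℕ) :
    ∑ x ∈ range h, (f (x + 1) - f x) * (c - 2 * ((x : ℝ) + 1)) =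
      f h * (c - 2 * h) + 2 * ∑ x ∈ range h, f x := by
  induction h with
  | zero => simp [hf]
  | succ h ih =>
    rw [sum_range_succ, sum_range_succ, ih]
    push_cast
    ring

/-- If, for each `x`, the number of sizes `b i` with `x ≤ b i ≤ n - x` is at most
`(n - 2 x) / w + 1`, then `∑ i, sepCount n k (b i)` is bounded as for evenly spaced sizes. -/
theorem sum_sepCount_le {ι : Type*} (s : Finset ι) (b : ι → ℕ) {n k w : ℕ} (hk : 1 ≤ k)
    (hw : 1 ≤ w) (hb : ∀ i ∈ s, b i ≤ n)
    (hE : ∀ x, 1 ≤ x → 2 * x ≤ n →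
      w * (s.filter (fun i => x ≤ b i ∧ b i + x ≤ n)).card + 2 * x ≤ n + w) :
    (w : ℝ) * ∑ i ∈ s, sepCount n k (b i) ≤
      ((k : ℝ) - 1) / ((k : ℝ) + 1) * ((n : ℝ) + 1) * n.choose k
        + ((w : ℝ) - 1) * n.choose k := by
  set h := n / 2 with hh
  set F := sepCount n k with hF
  have hF0 : F 0 = 0 := sepCount_zero hk
  -- Layer-cake form: by symmetry `b i` may be replaced by `min (b i) (n - b i)`, and `F` telescopes
  -- from `F 0 = 0`.
  have hlayer : ∀ i ∈ s, F (b i) =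
      ∑ x ∈ range h, if (x + 1 ≤ b i ∧ b i + (x + 1) ≤ n) then F (x + 1) - F x else 0 := by
    intro i hi
    have hbi := hb i hi
    have h1 : F (b i) = F (min (b i) (n - b i)) := by
      rcases le_total (b i) (n - b i) with h | h
      · rw [min_eq_left h]
      · rw [min_eq_right h, hF, sepCount_symm hbi]
    rw [h1, ← sum_filter]
    have h2 : (range h).filter (fun x => x + 1 ≤ b i ∧ b i + (x + 1) ≤ n)
        = range (min (b i) (n - b i)) := by
      ext x
      simp only [mem_filter, mem_range]
      omega
    rw [h2, sum_range_sub, hF0, sub_zero]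
  rw [sum_congr rfl hlayer, sum_comm]
  have h3 : ∀ x ∈ range h, (w : ℝ) * (∑ i ∈ s,
      if (x + 1 ≤ b i ∧ b i + (x + 1) ≤ n) then F (x + 1) - F x else 0) ≤
      (F (x + 1) - F x) * (((n : ℝ) + w) - 2 * ((x : ℝ) + 1)) := by
    intro x hx
    rw [mem_range] at hx
    rw [← sum_filter, sum_const, nsmul_eq_mul]
    have hE' := hE (x + 1) (by omega) (by omega)
    have hE'' : (w : ℝ) * ((s.filter (fun i => x + 1 ≤ b i ∧ b i + (x + 1) ≤ n)).card : ℝ)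
        ≤ ((n : ℝ) + w) - 2 * ((x : ℝ) + 1) := by
      have : ((w * (s.filter (fun i => x + 1 ≤ b i ∧ b i + (x + 1) ≤ n)).card
        + 2 * (x + 1) : ℕ) : ℝ) ≤ ((n + w : ℕ) : ℝ) := by exact_mod_cast hE'
      push_cast at this
      linarith
    have hpos : 0 ≤ F (x + 1) - F x := sub_nonneg.2 (sepCount_le_succ hk (by omega))
    rw [← mul_assoc, mul_comm]
    exact mul_le_mul_of_nonneg_left hE'' hpos
  rw [mul_sum]
  refine (sum_le_sum h3).trans ?_
  -- With c = n + w the bound exceeds the full sum of `F` by exactly (w - 1) `F h`, and `F h` ≤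
  -- C(n,k).
  rw [sum_increments_mul F hF0, ← sum_sepCount, ← sum_sepCount_half n k h (by omega)]
  have hw' : (0 : ℝ) ≤ (w : ℝ) - 1 := by
    have : (1 : ℝ) ≤ w := by exact_mod_cast hw
    linarith
  have := mul_le_mul_of_nonneg_left (sepCount_le n k h) hw'
  rw [← hF] at this ⊢
  linarith

/-! ### Steiner distance -/

namespace SimpleGraph

variable {V : Type*} {G : SimpleGraph V}

/-- Connectedness makes `⊤` admissible, so the infimum is attained and is not the default value 0.
-/
theorem Connected.exists_subgraph_steinerDist (hG : G.Connected) (S : Set V) :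
    ∃ H : G.Subgraph, H.Connected ∧ S ⊆ H.verts ∧ H.edgeSet.ncard = G.steinerDist S :=
  Nat.sInf_mem (s := {m : ℕ | ∃ H : G.Subgraph, H.Connected ∧ S ⊆ H.verts ∧
    H.edgeSet.ncard = m}) ⟨_, ⊤, ⟨Subgraph.topIso.connected_iff.2 hG⟩, fun _ _ => trivial, rfl⟩

theorem steinerDist_le {S : Set V} (H : G.Subgraph) (hH : H.Connected) (hS : S ⊆ H.verts) :
    G.steinerDist S ≤ H.edgeSet.ncard :=
  Nat.sInf_le ⟨H, hH, hS, rfl⟩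

theorem Connected.steinerDist_mono (hG : G.Connected) {S T : Set V} (h : S ⊆ T) :
    G.steinerDist S ≤ G.steinerDist T := by
  obtain ⟨H, hH, hT, hm⟩ := hG.exists_subgraph_steinerDist T
  exact hm ▸ steinerDist_le H hH (h.trans hT)

theorem steinerDist_singleton (v : V) : G.steinerDist {v} = 0 := by
  have := steinerDist_le (S := {v}) (G.singletonSubgraph v)
    Subgraph.singletonSubgraph_connected (by simp)
  simpa using this

theorem Walk.ncard_edgeSet_toSubgraph_le {u v : V} (p : G.Walk u v) :
    p.toSubgraph.edgeSet.ncard ≤ p.length := by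
  classical
  have : p.toSubgraph.edgeSet = (p.edges.toFinset : Set (Sym2 V)) := by
    ext e
    simp
  rw [this, Set.ncard_coe_finset, ← p.length_edges]
  exact List.toFinset_card_le _

/-- Attach a shortest path to an optimal subgraph. -/
theorem Connected.steinerDist_insert_le [Fintype V] (hG : G.Connected) {S : Set V} {x : V} (hx : x ∈ S)
    (y : V) : G.steinerDist (insert y S) ≤ G.steinerDist S + G.dist x y := by
  obtain ⟨H, hH, hS, hm⟩ := hG.exists_subgraph_steinerDist S
  obtain ⟨p, hp⟩ := hG.exists_walk_length_eq_dist x y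
  have hc : (H ⊔ p.toSubgraph).Connected :=
    Subgraph.connected_sup hH.preconnected p.toSubgraph_connected.preconnected ⟨x, hS hx, p.start_mem_verts_toSubgraph⟩
  refine (steinerDist_le _ hc ?_).trans ?_
  · rintro z (rfl | hz)
    · exact Or.inr p.end_mem_verts_toSubgraph
    · exact Or.inl (hS hz)
  · rw [Subgraph.edgeSet_sup, ← hm, ← hp]
    exact (Set.ncard_union_le _ _).trans
      (Nat.add_le_add_left p.ncard_edgeSet_toSubgraph_le _)

theorem Connected.steinerDist_union_le [Fintype V] (hG : G.Connected) {S : Set V} {c : ℕ} (T : Finset V)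
    (hT : ∀ t ∈ T, ∃ x ∈ S, G.dist x t ≤ c) :
    G.steinerDist (S ∪ T) ≤ G.steinerDist S + c * T.card := by
  classical
  induction T using Finset.induction_on with
  | empty => simp
  | insert a T ha ih =>
    have ih := ih fun t ht => hT t (mem_insert_of_mem ht)
    obtain ⟨x, hx, hxa⟩ := hT a (mem_insert_self _ _)
    have h1 := hG.steinerDist_insert_le (S := S ∪ T) (Or.inl hx) a
    rw [coe_insert, Set.union_insert, card_insert_of_notMem ha]
    linarith

end SimpleGraph

/-! ### Rooted trees and balanced edges -/

/-- A rooted tree on `I`, given by its parent function. -/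
structure ParentTree (I : Type*) where
  root : I
  parent : I → I
  rank : I → ℕ
  parent_root : parent root = root
  rank_parent_lt : ∀ i, i ≠ root → rank (parent i) < rank i

namespace ParentTree

variable {I : Type*} (T : ParentTree I)

/-- `T.Anc i j` holds if `i` is an ancestor of `j` or `j` itself. -/
def Anc (i j : I) : Prop := ∃ m : ℕ, T.parent^[m] j = i

variable {T}

theorem Anc.refl (i : I) : T.Anc i i := ⟨0, rfl⟩

theorem Anc.trans {i j l : I} (h : T.Anc i j) (h' : T.Anc j l) : T.Anc i l := by
  obtain ⟨a, rfl⟩ := h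
  obtain ⟨b, rfl⟩ := h'
  exact ⟨a + b, Function.iterate_add_apply ..⟩

theorem anc_parent (i : I) : T.Anc (T.parent i) i := ⟨1, rfl⟩

theorem rank_parent_le (i : I) : T.rank (T.parent i) ≤ T.rank i := by
  by_cases h : i = T.root
  · rw [h, T.parent_root]
  · exact (T.rank_parent_lt i h).le

theorem Anc.rank_le {i j : I} (h : T.Anc i j) : T.rank i ≤ T.rank j := by
  obtain ⟨m, rfl⟩ := h
  induction m with
  | zero => exact le_rfl
  | succ m ih =>
    rw [Function.iterate_succ_apply']
    exact (rank_parent_le _).trans ih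

theorem Anc.eq_or_parent {i j : I} (h : T.Anc i j) : i = j ∨ T.Anc i (T.parent j) := by
  obtain ⟨m, rfl⟩ := h
  cases m with
  | zero => exact Or.inl rfl
  | succ m => exact Or.inr ⟨m, rfl⟩

/-- The rank drops strictly at each step towards the root. This lets nodes extremal for rank serve
as lowest or highest nodes. -/
theorem Anc.eq_of_rank_le {i j : I} (h : T.Anc i j) (hr : T.rank j ≤ T.rank i) : i = j := by
  rcases h.eq_or_parent with h' | h'
  · exact h'
  · by_cases hj : j = T.root
    · subst hj
      obtain ⟨m, rfl⟩ := h
      exact Function.iterate_fixed T.parent_root m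
    · exact absurd (h'.rank_le.trans_lt (T.rank_parent_lt j hj)) (not_lt.2 hr)

theorem anc_root (i : I) : T.Anc T.root i := by
  induction h : T.rank i using Nat.strong_induction_on generalizing i with
  | _ m ih =>
    by_cases hi : i = T.root
    · exact hi ▸ Anc.refl _
    · exact (ih _ (h ▸ T.rank_parent_lt i hi) _ rfl).trans (anc_parent i)

theorem Anc.total {i i' j : I} (h : T.Anc i j) (h' : T.Anc i' j) :
    T.Anc i i' ∨ T.Anc i' i := by
  obtain ⟨a, rfl⟩ := h
  obtain ⟨b, rfl⟩ := h'
  rcases le_total a b with hab | hab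
  · obtain ⟨c, rfl⟩ := Nat.exists_eq_add_of_le' hab
    exact Or.inr ⟨c, (Function.iterate_add_apply ..).symm⟩
  · obtain ⟨c, rfl⟩ := Nat.exists_eq_add_of_le' hab
    exact Or.inl ⟨c, (Function.iterate_add_apply ..).symm⟩

variable {V : Type*} [Fintype V] (T) (π : V → I)

open Classical in
/-- The elements of `V` located at descendants of `i`. -/
noncomputable def branch (i : I) : Finset V := univ.filter fun v => T.Anc i (π v)

variable {T π}

theorem mem_branch {i : I} {v : V} : v ∈ T.branch π i ↔ T.Anc i (π v) := by
  simp [branch]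

theorem Anc.branch_subset {i j : I} (h : T.Anc i j) : T.branch π j ⊆ T.branch π i :=
  fun _ hv => mem_branch.2 (h.trans (mem_branch.1 hv))

/-- The classes of the nodes in `U` are disjoint from each other and from `A` and `B`. -/
theorem mul_card_add_le [DecidableEq V] [DecidableEq I] {w x : ℕ} (hπ : ∀ i, w ≤ (univ.filter fun v => π v = i).card)
    {A B : Finset V} {U : Finset I} (hAB : Disjoint A B) (hA : x ≤ A.card) (hB : x ≤ B.card)
    (hAU : ∀ v ∈ A, π v ∉ U) (hBU : ∀ v ∈ B, π v ∉ U) :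
    w * U.card + 2 * x ≤ Fintype.card V := by
  set C := univ.filter fun v => π v ∈ U
  have hC : w * U.card ≤ C.card := by
    rw [card_eq_sum_card_fiberwise (f := π) (t := U) (fun v hv => by simpa [C] using hv),
      mul_comm, ← smul_eq_mul]
    refine card_nsmul_le_sum _ _ _ fun i hi => (hπ i).trans (card_le_card ?_)
    intro v hv
    have hv' : π v = i := by simpa using hv
    simp [C, hv', hi]
  have h1 : Disjoint (A ∪ B) C := by
    rw [Finset.disjoint_left]
    intro v hv hvC
    have hvC : π v ∈ U := by simpa [C] using hvC
    rcases mem_union.1 hv with h | h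
    · exact hAU v h hvC
    · exact hBU v h hvC
  have h2 := card_le_univ (A ∪ B ∪ C)
  rw [card_union_of_disjoint h1, card_union_of_disjoint hAB] at h2
  omega

/-- In a tree with node weights at least `w` and total weight `n`, at most `(n - 2 x) / w + 1`
edges have weight at least `x` on both sides. -/
theorem mul_card_balanced_add_le [DecidableEq I] [Fintype I] {w x : ℕ}
    (hπ : ∀ i, w ≤ (univ.filter fun v => π v = i).card) (hx : 2 * x ≤ Fintype.card V) :
    w * ((univ.erase T.root).filter (fun i => x ≤ (T.branch π i).card ∧
      (T.branch π i).card + x ≤ Fintype.card V)).card + 2 * x ≤ Fintype.card V + w := by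
  classical
  set E := (univ.erase T.root).filter (fun i => x ≤ (T.branch π i).card ∧
      (T.branch π i).card + x ≤ Fintype.card V) with hE
  rcases E.eq_empty_or_nonempty with h0 | hne
  · rw [h0, card_empty]
    omega
  suffices h : ∃ (A B : Finset V) (U : Finset I), Disjoint A B ∧ x ≤ A.card ∧ x ≤ B.card ∧
      (∀ v ∈ A, π v ∉ U) ∧ (∀ v ∈ B, π v ∉ U) ∧ E.card ≤ U.card + 1 by
    obtain ⟨A, B, U, hAB, hA, hB, hAU, hBU, hc⟩ := h
    have h1 := mul_card_add_le hπ hAB hA hB hAU hBU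
    have h2 := Nat.mul_le_mul_left w hc
    rw [mul_add, mul_one] at h2
    omega
  have hEmem : ∀ {i}, i ∈ E → i ≠ T.root ∧ x ≤ (T.branch π i).card ∧
      (T.branch π i).card + x ≤ Fintype.card V := by
    intro i hi
    simpa [hE] using hi
  obtain ⟨i, hi, himax⟩ := exists_max_image E T.rank hne
  -- A node stands for the edge to its parent. If all of `E` lies on one path to the root, take what
  -- is below its lowest edge and above its highest; the classes of `E.erase i` lie in between.
  by_cases hchain : ∀ j ∈ E, T.Anc j i
  · obtain ⟨j, hj, hjmin⟩ := exists_min_image E T.rank hne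
    refine ⟨T.branch π i, (T.branch π j)ᶜ, E.erase i, ?_, (hEmem hi).2.1, ?_, ?_, ?_, ?_⟩
    · rw [Finset.disjoint_left]
      intro v hv hv'
      exact (mem_compl.1 hv') ((hchain j hj).branch_subset hv)
    · rw [card_compl]
      have := (hEmem hj).2.2
      omega
    · intro v hv hvE
      rw [mem_erase] at hvE
      exact hvE.1 ((mem_branch.1 hv).eq_of_rank_le (himax _ hvE.2)).symm
    · intro v hv hvE
      rw [mem_erase] at hvE
      rw [mem_compl, mem_branch] at hv
      rcases (hchain j hj).total (hchain _ hvE.2) with h | h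
      · exact hv h
      · exact hv ((h.eq_of_rank_le (hjmin _ hvE.2)) ▸ Anc.refl _)
    · rw [card_erase_of_mem hi]
      omega
  · push Not at hchain
    -- Otherwise `i` and a lowest `j` off its path have disjoint branches. Two nodes of `E` are
    -- lost, but the root, never in `E`, makes up for one.
    obtain ⟨j, hj, hjmax⟩ := exists_max_image (E.filter fun j => ¬ T.Anc j i) T.rank
      (by obtain ⟨j, hj, hji⟩ := hchain; exact ⟨j, mem_filter.2 ⟨hj, hji⟩⟩)
    rw [mem_filter] at hj
    obtain ⟨hj, hji⟩ := hj
    have hij : ¬ T.Anc i j := fun h => hji (h.eq_of_rank_le (himax j hj) ▸ Anc.refl _)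
    have hroot : ∀ l ∈ E, ¬ T.Anc l T.root := by
      intro l hl h
      exact (hEmem hl).1 (h.eq_of_rank_le (anc_root l).rank_le)
    refine ⟨T.branch π i, T.branch π j, insert T.root ((E.erase i).erase j), ?_,
      (hEmem hi).2.1, (hEmem hj).2.1, ?_, ?_, ?_⟩
    · rw [Finset.disjoint_left]
      intro v hv hv'
      rcases (mem_branch.1 hv).total (mem_branch.1 hv') with h | h
      · exact hij h
      · exact hji h
    · intro v hv hvE
      rw [mem_branch] at hv
      rw [mem_insert, mem_erase, mem_erase] at hvE
      rcases hvE with h | ⟨-, h1, h2⟩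
      · exact hroot i hi (h ▸ hv)
      · exact h1 (hv.eq_of_rank_le (himax _ h2)).symm
    · intro v hv hvE
      rw [mem_branch] at hv
      rw [mem_insert, mem_erase, mem_erase] at hvE
      rcases hvE with h | ⟨h1, -, h2⟩
      · exact hroot j hj (h ▸ hv)
      · exact h1 (hv.eq_of_rank_le (hjmax _ (mem_filter.2 ⟨h2, fun h => hji (hv.trans h)⟩))).symm
    · have hne' : j ≠ i := fun h => hji (h ▸ Anc.refl _)
      have hr : T.root ∉ (E.erase i).erase j := by
        intro h
        exact (hEmem (mem_of_mem_erase (mem_of_mem_erase h))).1 rfl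
      rw [card_insert_of_notMem hr, card_erase_of_mem (mem_erase.2 ⟨hne', hj⟩),
        card_erase_of_mem hi]
      omega

end ParentTree

/-! ### Steiner distance through a tree of darts -/

namespace SimpleGraph

variable {V : Type*} {G : SimpleGraph V}

/-- The two endpoints of a dart. -/
def Dart.ends (d : G.Dart) : Set V := {d.fst, d.snd}

/-- Passing from a set to a set enlarged by the ends of a dart at distance at most `c`. -/
theorem Connected.steinerDist_union_ends_le [Fintype V] (hG : G.Connected) {S : Set V} {c : ℕ}
    (d : G.Dart) (h : ∃ a ∈ S, ∃ b ∈ d.ends, G.dist a b ≤ c) :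
    G.steinerDist (S ∪ d.ends) ≤ G.steinerDist S + c + 1 := by
  obtain ⟨a, ha, b, hb, hab⟩ := h
  have h1 : G.dist d.fst d.snd = 1 := dist_eq_one_iff_adj.2 d.adj
  rcases hb with rfl | rfl
  · have h2 := hG.steinerDist_insert_le ha d.fst
    have h3 := hG.steinerDist_insert_le (Set.mem_insert d.fst S) d.snd
    have h4 : S ∪ d.ends = insert d.snd (insert d.fst S) := by
      ext v
      simp only [Dart.ends, Set.mem_union, Set.mem_insert_iff, Set.mem_singleton_iff]
      tauto
    rw [h4]
    omega
  · have h2 := hG.steinerDist_insert_le ha d.snd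
    have h3 := hG.steinerDist_insert_le (Set.mem_insert d.snd S) d.fst
    have h4 : S ∪ d.ends = insert d.fst (insert d.snd S) := by
      ext v
      simp only [Dart.ends, Set.mem_union, Set.mem_insert_iff, Set.mem_singleton_iff]
      tauto
    rw [dist_comm] at h1
    rw [h4]
    omega

theorem Connected.steinerDist_ends_le [Fintype V] (hG : G.Connected) (d : G.Dart) :
    G.steinerDist d.ends ≤ 1 := by
  have h := hG.steinerDist_union_ends_le (S := {d.fst}) (c := 0) d
    ⟨d.fst, rfl, d.fst, Or.inl rfl, by simp⟩
  rw [steinerDist_singleton] at h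
  exact (hG.steinerDist_mono Set.subset_union_right).trans h

variable {I : Type*} [DecidableEq I]

/-- The dart at `t` costs 1; each further dart costs at most 3 to reach from its parent and 1 for
its own edge. Removing a node of maximal rank keeps the parent condition. -/
theorem Connected.steinerDist_iUnion_ends_le [Fintype V] (hG : G.Connected) (T : ParentTree I)
    (e : I → G.Dart)
    (he : ∀ i, i ≠ T.root → ∃ a ∈ (e (T.parent i)).ends, ∃ b ∈ (e i).ends, G.dist a b ≤ 3)
    (t : I) (A : Finset I)
    (hA : ∀ i ∈ A, i ≠ T.root ∧ (T.parent i = t ∨ T.parent i ∈ A)) :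
    G.steinerDist {v | ∃ i ∈ insert t A, v ∈ (e i).ends} ≤ 1 + 4 * A.card := by
  induction A using Finset.induction_on_max_value T.rank with
  | empty => simpa using hG.steinerDist_ends_le (e t)
  | insert a s ha hmax ih =>
    have ih := ih fun i hi => by
      obtain ⟨h1, h2⟩ := hA i (mem_insert_of_mem hi)
      refine ⟨h1, h2.imp_right fun h => (mem_insert.1 h).resolve_left fun h' => ?_⟩
      have h3 := T.rank_parent_lt i h1
      have h4 := hmax i hi
      rw [h'] at h3
      omega
    obtain ⟨h1, h2⟩ := hA a (mem_insert_self _ _)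
    have hp : T.parent a ∈ insert t s := by
      rcases h2 with h | h
      · exact h ▸ mem_insert_self _ _
      · refine mem_insert_of_mem ((mem_insert.1 h).resolve_left fun h' => ?_)
        have h3 := T.rank_parent_lt a h1
        rw [h'] at h3
        exact lt_irrefl _ h3
    obtain ⟨x, hx, y, hy, hxy⟩ := he a h1
    have h5 := hG.steinerDist_union_ends_le (S := {v | ∃ i ∈ insert t s, v ∈ (e i).ends}) (e a)
      ⟨x, ⟨_, hp, hx⟩, y, hy, hxy⟩
    have h6 : {v | ∃ i ∈ insert t (insert a s), v ∈ (e i).ends} =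
        {v | ∃ i ∈ insert t s, v ∈ (e i).ends} ∪ (e a).ends := by
      ext v
      simp only [mem_insert, Set.mem_ofPred_eq, Set.mem_union]
      constructor
      · rintro ⟨i, rfl | rfl | hi, hv⟩
        · exact Or.inl ⟨i, Or.inl rfl, hv⟩
        · exact Or.inr hv
        · exact Or.inl ⟨i, Or.inr hi, hv⟩
      · rintro (⟨i, rfl | hi, hv⟩ | hv)
        · exact ⟨i, Or.inl rfl, hv⟩
        · exact ⟨i, Or.inr (Or.inr hi), hv⟩
        · exact ⟨a, Or.inr (Or.inl rfl), hv⟩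
    rw [h6, card_insert_of_notMem ha]
    omega

/-- The Steiner distance of `S` is controlled by the number of tree edges separating `S`. -/
theorem Connected.steinerDist_le_card_separating [Fintype V] [DecidableEq V] [Fintype I]
    (hG : G.Connected) (T : ParentTree I) (e : I → G.Dart)
    (he : ∀ i, i ≠ T.root → ∃ a ∈ (e (T.parent i)).ends, ∃ b ∈ (e i).ends, G.dist a b ≤ 3)
    (π : V → I) (hπ : ∀ v, ∃ a ∈ (e (π v)).ends, G.dist a v ≤ 3) (S : Finset V) :
    G.steinerDist (S : Set V) ≤ 1 + 3 * S.card + 4 * ((univ.erase T.root).filter fun i =>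
      (∃ s ∈ S, s ∈ T.branch π i) ∧ ∃ s ∈ S, s ∉ T.branch π i).card := by
  classical
  set A := (univ.erase T.root).filter fun i =>
      (∃ s ∈ S, s ∈ T.branch π i) ∧ ∃ s ∈ S, s ∉ T.branch π i with hAdef
  have hAmem : ∀ {i}, i ∈ A ↔ i ≠ T.root ∧
      (∃ s ∈ S, s ∈ T.branch π i) ∧ ∃ s ∈ S, s ∉ T.branch π i := by
    intro i
    simp [hAdef]
  -- `t` is a lowest node whose branch contains all of `S`. The separating edges hang below it and,
  -- with `t`, form a subtree.
  obtain ⟨t, ht, htmax⟩ := exists_max_image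
    (univ.filter fun i : I => ∀ s ∈ S, s ∈ T.branch π i) T.rank
    ⟨T.root, by simp [ParentTree.mem_branch, ParentTree.anc_root]⟩
  have htS : ∀ s ∈ S, s ∈ T.branch π t := by simpa using ht
  have hbelow : ∀ i ∈ A, T.Anc t i ∧ i ≠ t := by
    intro i hi
    obtain ⟨-, ⟨s, hs, hsi⟩, s', hs', hsi'⟩ := hAmem.1 hi
    rcases (ParentTree.mem_branch.1 hsi).total (ParentTree.mem_branch.1 (htS s hs)) with h | h
    · exact absurd (h.branch_subset (htS s' hs')) hsi'
    · exact ⟨h, fun h' => hsi' (h' ▸ htS s' hs')⟩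
  have hA : ∀ i ∈ A, i ≠ T.root ∧ (T.parent i = t ∨ T.parent i ∈ A) := by
    intro i hi
    obtain ⟨hir, ⟨s, hs, hsi⟩, -⟩ := hAmem.1 hi
    obtain ⟨h1, h2⟩ := hbelow i hi
    have h3 : T.Anc t (T.parent i) := h1.eq_or_parent.resolve_left h2.symm
    refine ⟨hir, ?_⟩
    by_cases hall : ∀ s ∈ S, s ∈ T.branch π (T.parent i)
    · exact Or.inl (h3.eq_of_rank_le (htmax _ (by simpa using hall))).symm
    · push Not at hall
      refine Or.inr (hAmem.2 ⟨fun hr => ?_,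
        ⟨s, hs, (ParentTree.anc_parent i).branch_subset hsi⟩, hall⟩)
      obtain ⟨s', -, hs'⟩ := hall
      exact hs' (hr ▸ ParentTree.mem_branch.2 (ParentTree.anc_root _))
  have h1 := hG.steinerDist_iUnion_ends_le T e he t A hA
  -- The dart of each `s` is in this subtree, so attaching `s` costs at most 3.
  have hcov : ∀ s ∈ S, ∃ x ∈ {v | ∃ i ∈ insert t A, v ∈ (e i).ends}, G.dist x s ≤ 3 := by
    intro s hs
    obtain ⟨a, ha, has⟩ := hπ s
    refine ⟨a, ⟨π s, ?_, ha⟩, has⟩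
    have hself : s ∈ T.branch π (π s) := ParentTree.mem_branch.2 (ParentTree.Anc.refl _)
    by_cases hall : ∀ s' ∈ S, s' ∈ T.branch π (π s)
    · have h3 : T.Anc t (π s) := ParentTree.mem_branch.1 (htS s hs)
      rw [← h3.eq_of_rank_le (htmax _ (by simpa using hall))]
      exact mem_insert_self _ _
    · push Not at hall
      refine mem_insert_of_mem (hAmem.2 ⟨fun hr => ?_, ⟨s, hs, hself⟩, hall⟩)
      obtain ⟨s', -, hs'⟩ := hall
      exact hs' (hr ▸ ParentTree.mem_branch.2 (ParentTree.anc_root _))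
  have h2 := hG.steinerDist_union_le S hcov
  have h3 := hG.steinerDist_mono (S := (S : Set V)) (Set.subset_union_right
    (s := {v | ∃ i ∈ insert t A, v ∈ (e i).ends}))
  omega

/-- Double counting of pairs of a k-set and a tree edge separating it. -/
theorem Connected.steinerWiener_le_of_tree [Fintype V] [DecidableEq V] [Fintype I]
    (hG : G.Connected) (T : ParentTree I) (e : I → G.Dart)
    (he : ∀ i, i ≠ T.root → ∃ a ∈ (e (T.parent i)).ends, ∃ b ∈ (e i).ends, G.dist a b ≤ 3)
    (π : V → I) (hπ : ∀ v, ∃ a ∈ (e (π v)).ends, G.dist a v ≤ 3) {w k : ℕ} (hw : 1 ≤ w)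
    (hk : 1 ≤ k) (hπw : ∀ i, w ≤ (univ.filter fun v => π v = i).card) :
    (w : ℝ) * G.steinerWiener k ≤ w * (1 + 3 * k) * (Fintype.card V).choose k +
      4 * (((k : ℝ) - 1) / ((k : ℝ) + 1) * ((Fintype.card V : ℝ) + 1)
        * (Fintype.card V).choose k + ((w : ℝ) - 1) * (Fintype.card V).choose k) := by
  set n := Fintype.card V with hn
  set P := (univ : Finset V).powersetCard k with hP
  have h1 : (G.steinerWiener k : ℝ) ≤ (1 + 3 * k) * n.choose k +
      4 * ∑ i ∈ univ.erase T.root, sepCount n k (T.branch π i).card := by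
    have h2 : G.steinerWiener k ≤ ∑ S ∈ P, (1 + 3 * k + 4 * ((univ.erase T.root).filter fun i =>
        (∃ s ∈ S, s ∈ T.branch π i) ∧ ∃ s ∈ S, s ∉ T.branch π i).card) := by
      refine sum_le_sum fun S hS => ?_
      rw [← (mem_powersetCard.1 hS).2]
      exact hG.steinerDist_le_card_separating T e he π hπ S
    have hswap : ∑ S ∈ P, ((univ.erase T.root).filter fun i =>
        (∃ s ∈ S, s ∈ T.branch π i) ∧ ∃ s ∈ S, s ∉ T.branch π i).card =
        ∑ i ∈ univ.erase T.root, (P.filter fun S =>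
          (∃ s ∈ S, s ∈ T.branch π i) ∧ ∃ s ∈ S, s ∉ T.branch π i).card :=
      sum_card_bipartiteAbove_eq_sum_card_bipartiteBelow _
    rw [sum_add_distrib, ← mul_sum, sum_const, card_powersetCard, card_univ, ← hn, hswap] at h2
    have h3 : ((G.steinerWiener k : ℕ) : ℝ) ≤ _ := Nat.cast_le.2 h2
    push_cast at h3
    rw [smul_eq_mul, mul_comm] at h3
    push_cast at h3
    refine h3.trans (le_of_eq ?_)
    congr 2
    refine sum_congr rfl fun i _ => ?_
    exact card_separated hk (T.branch π i)
  have h4 := sum_sepCount_le (univ.erase T.root) (fun i => (T.branch π i).card) (n := n) hk hw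
    (fun i _ => card_le_univ _) (fun x _ hx => ParentTree.mul_card_balanced_add_le hπw hx)
  have h5 := mul_le_mul_of_nonneg_left h1 (Nat.cast_nonneg (α := ℝ) w)
  linarith

end SimpleGraph

/-! ### Building the dart tree and the classes -/

namespace SimpleGraph

variable {V : Type*} {G : SimpleGraph V}

/-- A set of darts that are pairwise at distance at least `3`, together with a rooted tree
structure in which each dart is at distance at most `3` from its parent. -/
structure DartTree (G : SimpleGraph V) where
  darts : Finset G.Dart
  tree : ParentTree darts
  le_dist : ∀ i ∈ darts, ∀ j ∈ darts, i ≠ j → ∀ a ∈ i.ends, ∀ b ∈ j.ends, 3 ≤ G.dist a b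
  dist_parent_le : ∀ i, i ≠ tree.root →
    ∃ a ∈ (tree.parent i).1.ends, ∃ b ∈ i.1.ends, G.dist a b ≤ 3

/-- The tree with a single dart. -/
def DartTree.single (d : G.Dart) : DartTree G where
  darts := {d}
  tree :=
    { root := ⟨d, mem_singleton_self d⟩
      parent := id
      rank := fun _ => 0
      parent_root := rfl
      rank_parent_lt := fun i hi => absurd (Subtype.ext (mem_singleton.1 i.2)) hi }
  le_dist := by
    intro i hi j hj hij
    rw [mem_singleton] at hi hj
    exact absurd (hi.trans hj.symm) hij
  dist_parent_le := fun i hi => absurd (Subtype.ext (mem_singleton.1 i.2)) hi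

/-- The new dart becomes a leaf below a nearby dart, with rank one higher. -/
theorem DartTree.exists_insert (D : DartTree G) (d : G.Dart)
    (hfar : ∀ i ∈ D.darts, ∀ a ∈ i.ends, ∀ b ∈ d.ends, 3 ≤ G.dist a b)
    (hnear : ∃ i ∈ D.darts, ∃ a ∈ i.ends, ∃ b ∈ d.ends, G.dist a b ≤ 3) :
    ∃ D' : DartTree G, D'.darts.card = D.darts.card + 1 := by
  classical
  obtain ⟨i₀, hi₀, hnear⟩ := hnear
  have hd : d ∉ D.darts := by
    intro h
    have := hfar d h d.fst (Or.inl rfl) d.fst (Or.inl rfl)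
    simp at this
  have hmem : ∀ i : D.darts, i.1 ∈ insert d D.darts := fun i => mem_insert_of_mem i.2
  have hcase : ∀ i : ↥(insert d D.darts), i.1 ≠ d → i.1 ∈ D.darts := fun i h =>
    (mem_insert.1 i.2).resolve_left h
  let par : ↥(insert d D.darts) → ↥(insert d D.darts) := fun i =>
    if h : i.1 = d then ⟨i₀, mem_insert_of_mem hi₀⟩
    else ⟨(D.tree.parent ⟨i.1, hcase i h⟩).1, hmem _⟩
  let rk : ↥(insert d D.darts) → ℕ := fun i =>
    if h : i.1 = d then D.tree.rank ⟨i₀, hi₀⟩ + 1 else D.tree.rank ⟨i.1, hcase i h⟩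
  have hneq : ∀ i : D.darts, i.1 ≠ d := fun i h => hd (h ▸ i.2)
  have hi₀d : i₀ ≠ d := hneq ⟨i₀, hi₀⟩
  refine ⟨⟨insert d D.darts, ⟨⟨D.tree.root.1, hmem _⟩, par, rk, ?_, ?_⟩, ?_, ?_⟩, ?_⟩
  · have h := hneq D.tree.root
    simp only [par, h, dif_neg, not_false_eq_true]
    exact Subtype.ext (show (D.tree.parent D.tree.root).1 = D.tree.root.1 by
      rw [D.tree.parent_root])
  · intro i hi
    by_cases h : i.1 = d
    · simp [par, rk, h, hi₀d]
    · have hr : (⟨i.1, hcase i h⟩ : D.darts) ≠ D.tree.root :=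
        fun h' => hi (Subtype.ext (show i.1 = D.tree.root.1 by rw [← h']))
      have := D.tree.rank_parent_lt _ hr
      simpa [par, rk, h, hneq] using this
  · intro i hi j hj hij a ha b hb
    rcases mem_insert.1 hi with rfl | hi'
    · rcases mem_insert.1 hj with rfl | hj'
      · exact absurd rfl hij
      · rw [dist_comm]
        exact hfar j hj' b hb a ha
    · rcases mem_insert.1 hj with rfl | hj'
      · exact hfar i hi' a ha b hb
      · exact D.le_dist i hi' j hj' hij a ha b hb
  · intro i hi
    by_cases h : i.1 = d
    · simpa [par, h] using hnear
    · have hr : (⟨i.1, hcase i h⟩ : D.darts) ≠ D.tree.root :=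
        fun h' => hi (Subtype.ext (show i.1 = D.tree.root.1 by rw [← h']))
      have := D.dist_parent_le _ hr
      simpa only [par, h, dif_neg, not_false_eq_true] using this
  · exact card_insert_of_notMem hd

/-- There is a dart tree within distance `3` of every vertex. -/
theorem Connected.exists_dartTree [Fintype V] (hG : G.Connected) (d₀ : G.Dart) :
    ∃ D : DartTree G, ∀ v, ∃ i ∈ D.darts, ∃ a ∈ i.ends, G.dist a v ≤ 3 := by
  classical
  have hbdd : ∀ m, (∃ D : DartTree G, D.darts.card = m) → m ≤ Fintype.card G.Dart := by
    rintro _ ⟨D, rfl⟩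
    exact card_le_univ _
  obtain ⟨D, hD⟩ := Nat.findGreatest_spec (P := fun m => ∃ D : DartTree G, D.darts.card = m)
    (hbdd 1 ⟨.single d₀, card_singleton _⟩) ⟨.single d₀, card_singleton _⟩
  refine ⟨D, fun v => ?_⟩
  by_contra hv
  set X : Set V := {v | ∃ i ∈ D.darts, ∃ a ∈ i.ends, G.dist a v ≤ 3} with hX
  obtain ⟨p⟩ := hG.preconnected D.tree.root.1.fst v
  -- A walk to an uncovered vertex leaves `X` along some `d`. Its head is at distance at least 4
  -- from the family, so its tail is at distance exactly 3, and `d` could be added to a tree of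
  -- maximal size.
  obtain ⟨d, -, ⟨i₀, hi₀, a₀, ha₀, hda⟩, hd⟩ := p.exists_boundary_dart X
    ⟨_, D.tree.root.2, _, Or.inl rfl, by simp⟩ hv
  have hsnd : ∀ i ∈ D.darts, ∀ a ∈ i.ends, 4 ≤ G.dist a d.snd := by
    intro i hi a ha
    by_contra h
    exact hd ⟨i, hi, a, ha, by omega⟩
  obtain ⟨D', hD'⟩ := D.exists_insert d (by
    rintro i hi a ha b (rfl | rfl)
    · have h1 := hsnd i hi a ha
      have h2 := hG.dist_triangle (u := a) (v := d.fst) (w := d.snd)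
      rw [dist_eq_one_iff_adj.2 d.adj] at h2
      omega
    · exact (by omega : 3 ≤ 4).trans (hsnd i hi a ha))
    ⟨i₀, hi₀, a₀, ha₀, d.fst, Or.inl rfl, hda⟩
  have h3 := Nat.le_findGreatest (P := fun m => ∃ D : DartTree G, D.darts.card = m)
    (hbdd _ ⟨D', rfl⟩) ⟨D', rfl⟩
  omega

/-- Adjacent vertices of a triangle-free graph have no common neighbour. -/
theorem two_mul_minDegree_le_card [Fintype V] [DecidableEq V] [DecidableRel G.Adj]
    (htri : G.CliqueFree 3) (d : G.Dart) :
    2 * G.minDegree ≤ (G.neighborFinset d.fst ∪ G.neighborFinset d.snd).card := by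
  have hdisj : Disjoint (G.neighborFinset d.fst) (G.neighborFinset d.snd) := by
    rw [Finset.disjoint_left]
    intro v h1 h2
    rw [mem_neighborFinset] at h1 h2
    exact htri {d.fst, d.snd, v} (is3Clique_triple_iff.2 ⟨d.adj, h1, h2⟩)
  rw [card_union_of_disjoint hdisj, card_neighborFinset_eq_degree,
    card_neighborFinset_eq_degree]
  have h1 := G.minDegree_le_degree d.fst
  have h2 := G.minDegree_le_degree d.snd
  omega

/-- Each vertex can be assigned to a dart of the tree so that all the classes are large. -/
theorem DartTree.exists_assignment [Fintype V] [DecidableEq V] [DecidableRel G.Adj]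
    (hG : G.Connected) (htri : G.CliqueFree 3) (D : DartTree G)
    (hD : ∀ v, ∃ i ∈ D.darts, ∃ a ∈ i.ends, G.dist a v ≤ 3) :
    ∃ π : V → D.darts, (∀ v, ∃ a ∈ (π v).1.ends, G.dist a v ≤ 3) ∧
      ∀ i, 2 * G.minDegree ≤ (univ.filter fun v => π v = i).card := by
  -- A vertex adjacent to ends of two different darts would put these at distance at most 2, so the
  -- forced choice is consistent.
  have h : ∀ v, ∃ i : D.darts, (∃ a ∈ i.1.ends, G.dist a v ≤ 3) ∧
      ∀ j : D.darts, (∃ b ∈ j.1.ends, G.Adj b v) → i = j := by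
    intro v
    by_cases hv : ∃ i : D.darts, ∃ a ∈ i.1.ends, G.Adj a v
    · obtain ⟨i, a, ha, hav⟩ := hv
      refine ⟨i, ⟨a, ha, by rw [dist_eq_one_iff_adj.2 hav]; omega⟩, ?_⟩
      rintro j ⟨b, hb, hbv⟩
      by_contra hij
      have h1 := D.le_dist i i.2 j j.2 (fun h => hij (Subtype.ext h)) a ha b hb
      have h2 := hG.dist_triangle (u := a) (v := v) (w := b)
      rw [dist_eq_one_iff_adj.2 hav, dist_eq_one_iff_adj.2 hbv.symm] at h2
      omega
    · obtain ⟨i, hi, hi'⟩ := hD v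
      exact ⟨⟨i, hi⟩, hi', fun j hj => absurd ⟨j, hj⟩ hv⟩
  choose π hπ hπ' using h
  refine ⟨π, hπ, fun i => (two_mul_minDegree_le_card htri i.1).trans (card_le_card ?_)⟩
  intro v hv
  rw [mem_union, mem_neighborFinset, mem_neighborFinset] at hv
  rw [mem_filter]
  refine ⟨mem_univ _, hπ' v i ?_⟩
  rcases hv with hv | hv
  · exact ⟨_, Or.inl rfl, hv⟩
  · exact ⟨_, Or.inr rfl, hv⟩

end SimpleGraph

/-! ### The bound -/

theorem corollary2 {V : Type*} [Fintype V] (G : SimpleGraph V) [DecidableRel G.Adj]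
    (n δ k : ℕ) (hconn : G.Connected) (htri : G.CliqueFree 3)
    (hn : Fintype.card V = n) (hδ : G.minDegree = δ) (hδpos : 1 ≤ δ) (hk : 1 ≤ k) :
    (G.steinerWiener k : ℝ) ≤
        ((k : ℝ) - 1) / ((k : ℝ) + 1) * (2 * ((n : ℝ) + 1) / (δ : ℝ)) * (n.choose k : ℝ)
          + ((4 * (δ : ℝ) - 2) / (δ : ℝ) + 3 * (k : ℝ) + 1) * (n.choose k : ℝ) ∧
      (k ≤ n →
        G.avgSteinerDist k ≤
          ((k : ℝ) - 1) / ((k : ℝ) + 1) * (2 * ((n : ℝ) + 1) / (δ : ℝ))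
            + (4 * (δ : ℝ) - 2) / (δ : ℝ) + 3 * (k : ℝ) + 1) := by
  classical
  have hmain : (G.steinerWiener k : ℝ) ≤
      ((k : ℝ) - 1) / ((k : ℝ) + 1) * (2 * ((n : ℝ) + 1) / (δ : ℝ)) * (n.choose k : ℝ)
        + ((4 * (δ : ℝ) - 2) / (δ : ℝ) + 3 * (k : ℝ) + 1) * (n.choose k : ℝ) := by
    obtain ⟨u⟩ := hconn.nonempty
    obtain ⟨v, huv⟩ := (G.degree_pos_iff_exists_adj u).1
      (by have := G.minDegree_le_degree u; omega)
    obtain ⟨D, hD⟩ := hconn.exists_dartTree ⟨(u, v), huv⟩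
    obtain ⟨π, hπ, hπw⟩ := D.exists_assignment hconn htri hD
    -- Here w = 2δ, so 4/w = 2/δ and 4(w - 1)/w = (4δ - 2)/δ.
    have h := hconn.steinerWiener_le_of_tree D.tree Subtype.val D.dist_parent_le π hπ
      (by omega) hk hπw
    rw [hn, hδ] at h
    push_cast at h
    have hδ0 : (0 : ℝ) < δ := by exact_mod_cast hδpos
    refine le_of_mul_le_mul_left (h.trans (le_of_eq ?_)) (by positivity : (0 : ℝ) < 2 * δ)
    field_simp
    ring
  refine ⟨hmain, fun hkn => ?_⟩
  have hc : (0 : ℝ) < n.choose k := by exact_mod_cast Nat.choose_pos hkn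
  rw [SimpleGraph.avgSteinerDist, hn, inv_mul_le_iff₀ hc]
  linarith
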